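/- Let $n\ge 1$ and $0\le j\le n$ be integers, and let $\omega_k$ denote the volume of the unit ball of $\mathbb{R}^k$ ($\omega_0=1$). Let $G_{n,j}$ be the Grassmann manifold of $j$-dimensional linear subspaces of $\mathbb{R}^n$, and let $\mu_j$ be its normalized Haar measure, that is, its rotation invariant Borel probability measure. For nonempty compact convex sets $K_1,\dots,K_j\subset\mathbb{R}^n$ (in particular, for convex bodies with interior points, or with the origin in their interiors) and $\xi\in G_{n,j}$, let $\mathrm{vol}_j((K_1,\dots,K_j)|\xi)$ denote the mixed volume, in the $j$-dimensional Euclidean space $\xi$, of the orthogonal projections $K_1|\xi,\dots,K_j|\xi$; here the mixed volume of $j$ convex bodies $L_1,\dots,L_j$ in a $j$-dimensional Euclidean space is $$V(L_1,\dots,L_j)=\frac1{j!}\sum_{S\subseteq\{1,\dots,j\}}(-1)^{j-|S|}\,\mathrm{vol}_j\Big(\sum_{i\in S}L_i\Big),$$ with Minkowski sums, the empty sum being $\{0\}$. The mixed affine quermassintegral of $K_1,\dots,K_j$ is $$\Phi_{n-j}(K_1,\dots,K_j)=\omega_n\left[\int_{G_{n,j}}\left(\frac{\mathrm{vol}_j((K_1,\dots,K_j)|\xi)}{\omega_j}\right)^{-n}d\mu_j(\xi)\right]^{-1/n},$$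 where $0^{-n}=\infty$ and $\infty^{-1/n}=0$. Then for all nonempty compact convex sets $K_1,\dots,K_j\subset\mathbb{R}^n$ and every $g\in \mathrm{SL}(n)$ (the real $n\times n$ matrices of determinant $1$), $$\Phi_{n-j}(gK_1,\dots,gK_j)=\Phi_{n-j}(K_1,\dots,K_j).$$ -/

import Mathlib

open MeasureTheory

noncomputable section

/-- The image of a convex body (nonempty compact convex set) under a continuous linear map. -/
def ConvexBody.mapCLM {V W : Type*} [NormedAddCommGroup V] [NormedSpace ℝ V]
    [NormedAddCommGroup W] [NormedSpace ℝ W] (f : V →L[ℝ] W) (K : ConvexBody V) :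
    ConvexBody W where
  carrier := f '' (K : Set V)
  convex' := K.convex.linear_image (f : V →ₗ[ℝ] W)
  isCompact' := K.isCompact.image f.continuous
  nonempty' := K.nonempty.image f

/-- The mixed volume of `j` convex bodies in a Euclidean space `E` (of dimension `j`), by
polarization of the volume:
`V(K₁, …, K_j) = (1 / j!) ∑_{S ⊆ {1, …, j}} (-1) ^ (j - |S|) vol (∑_{i ∈ S} K_i)`,
with Minkowski sums of bodies; the empty sum is the body `{0}`. -/
def mixedVolume {E : Type*} [NormedAddCommGroup E] [InnerProductSpace ℝ E]
    [FiniteDimensional ℝ E] [MeasurableSpace E] [BorelSpace E] {j : ℕ}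
    (K : Fin j → ConvexBody E) : ℝ :=
  (1 / (j.factorial : ℝ)) *
    ∑ S : Finset (Fin j), (-1 : ℝ) ^ (j - S.card) *
      (volume : Measure E).real ((∑ i ∈ S, K i : ConvexBody E) : Set E)

/-- The volume `ω_j` of the Euclidean unit ball of `ℝ^j`. -/
def unitBallVolume (j : ℕ) : ENNReal :=
  volume (Metric.closedBall (0 : EuclideanSpace ℝ (Fin j)) 1)

/-- The Grassmann manifold `G_{n,j}` of `j`-dimensional linear subspaces of `ℝ^n`. -/
structure RealGrassmannian (n j : ℕ) where
  /-- the underlying subspace -/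
  toSubmodule : Submodule ℝ (EuclideanSpace ℝ (Fin n))
  finrank_eq : Module.finrank ℝ toSubmodule = j

namespace RealGrassmannian

/-- The usual topology of `G_{n,j}`: a subspace is identified with the orthogonal projection
onto it, and operators carry the operator norm. -/
instance (n j : ℕ) : TopologicalSpace (RealGrassmannian n j) :=
  TopologicalSpace.induced
    (fun ξ : RealGrassmannian n j => ξ.1.starProjection) inferInstance

instance (n j : ℕ) : MeasurableSpace (RealGrassmannian n j) := borel _

instance (n j : ℕ) : BorelSpace (RealGrassmannian n j) := ⟨rfl⟩

/-- The coordinate subspace spanned by the first `j` standard basis vectors of `ℝ^n`. -/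
def coordinate {n j : ℕ} (hj : j ≤ n) : RealGrassmannian n j :=
  ⟨Submodule.span ℝ (Set.range fun i : Fin j =>
      EuclideanSpace.basisFun (Fin n) ℝ (Fin.castLE hj i)), by
    have h := (EuclideanSpace.basisFun (Fin n) ℝ).orthonormal.linearIndependent.comp
      (Fin.castLE hj) (Fin.castLE_injective hj)
    exact (finrank_span_eq_card h).trans (Fintype.card_fin j)⟩

end RealGrassmannian

instance (n : ℕ) : MeasurableSpace (Matrix.orthogonalGroup (Fin n) ℝ) := borel _

instance (n : ℕ) : BorelSpace (Matrix.orthogonalGroup (Fin n) ℝ) := ⟨rfl⟩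

instance (n : ℕ) : CompactSpace (Matrix.orthogonalGroup (Fin n) ℝ) := by
  refine (isCompact_iff_compactSpace
    (s := (Matrix.orthogonalGroup (Fin n) ℝ : Set (Matrix (Fin n) (Fin n) ℝ)))).mp ?_
  have hc : IsClosed (Matrix.orthogonalGroup (Fin n) ℝ : Set (Matrix (Fin n) (Fin n) ℝ)) := by
    have : (Matrix.orthogonalGroup (Fin n) ℝ : Set (Matrix (Fin n) (Fin n) ℝ)) =
        {A | A * star A = 1} := by
      ext A
      exact Matrix.mem_orthogonalGroup_iff (Fin n) ℝ
    rw [this]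
    exact isClosed_eq (by fun_prop) continuous_const
  have hK : IsCompact (Set.univ.pi fun _ => Set.univ.pi fun _ => Metric.closedBall 0 1 :
      Set (Fin n → Fin n → ℝ)) :=
    isCompact_univ_pi fun _ => isCompact_univ_pi fun _ => isCompact_closedBall _ _
  refine IsCompact.of_isClosed_subset (X := Fin n → Fin n → ℝ) hK hc ?_
  intro A hA i _ k _
  simpa using entry_norm_bound_of_unitary (𝕜 := ℝ) hA i k

/-- The normalized Haar measure on the orthogonal group `O(n)`. -/
def orthogonalHaar (n : ℕ) : Measure (Matrix.orthogonalGroup (Fin n) ℝ) :=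
  Measure.haarMeasure ⊤

/-- The linear isometry of `ℝ^n` given by an orthogonal matrix. -/
def orthogonalIsometry {n : ℕ} (U : Matrix.orthogonalGroup (Fin n) ℝ) :
    EuclideanSpace ℝ (Fin n) ≃ₗᵢ[ℝ] EuclideanSpace ℝ (Fin n) :=
  Unitary.linearIsometryEquiv ⟨Matrix.toEuclideanCLM (n := Fin n) (𝕜 := ℝ) U.1,
    Unitary.map_mem _ U.2⟩

namespace RealGrassmannian

/-- The image `U ξ` of a subspace `ξ` under an orthogonal matrix `U`. -/
def rotate {n j : ℕ} (U : Matrix.orthogonalGroup (Fin n) ℝ) (ξ : RealGrassmannian n j) :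
    RealGrassmannian n j :=
  ⟨ξ.1.map ((orthogonalIsometry U).toLinearEquiv :
      EuclideanSpace ℝ (Fin n) →ₗ[ℝ] EuclideanSpace ℝ (Fin n)), by
    rw [LinearEquiv.finrank_map_eq]; exact ξ.2⟩

/-- The normalized Haar measure `μ_j` on `G_{n,j}`, that is, the rotation invariant Borel
probability measure: the distribution of `U ξ₀` for a fixed `j`-dimensional subspace `ξ₀` and a
Haar distributed random `U` in `O(n)`. -/
def haar {n j : ℕ} (hj : j ≤ n) : Measure (RealGrassmannian n j) :=
  (orthogonalHaar n).map fun U => rotate U (coordinate hj)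

theorem continuous_rotate {n j : ℕ} (ξ : RealGrassmannian n j) :
    Continuous fun U : Matrix.orthogonalGroup (Fin n) ℝ => rotate U ξ := by
  refine continuous_induced_rng.mpr ?_
  let T := Matrix.toEuclideanCLM (n := Fin n) (𝕜 := ℝ)
  have hT : Continuous T := T.toAlgEquiv.toLinearMap.continuous_of_finiteDimensional
  have h : ((fun η : RealGrassmannian n j => η.1.starProjection) ∘
      fun U : Matrix.orthogonalGroup (Fin n) ℝ => rotate U ξ) =
      fun U => T U.1 * ξ.1.starProjection * T (star U.1) := by
    funext U
    refine ContinuousLinearMap.ext fun x => ?_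
    refine (Submodule.starProjection_map_apply (orthogonalIsometry U) ξ.1 x).trans ?_
    rw [map_star]
    rfl
  rw [h]
  have h1 : Continuous fun U : Matrix.orthogonalGroup (Fin n) ℝ => T U.1 :=
    hT.comp continuous_subtype_val
  have h2 : Continuous fun U : Matrix.orthogonalGroup (Fin n) ℝ => T (star U.1) :=
    hT.comp continuous_subtype_val.star
  exact (h1.mul continuous_const).mul h2

instance {n j : ℕ} (hj : j ≤ n) : IsProbabilityMeasure (haar hj) := by
  have : IsProbabilityMeasure (orthogonalHaar n) := ⟨by
    simpa [orthogonalHaar] using Measure.haarMeasure_self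
      (K₀ := (⊤ : TopologicalSpace.PositiveCompacts (Matrix.orthogonalGroup (Fin n) ℝ)))⟩
  exact Measure.isProbabilityMeasure_map (continuous_rotate _).measurable.aemeasurable

end RealGrassmannian

/-- `vol_j ((K₁, …, K_j) | ξ)`: the mixed volume, in the `j`-dimensional Euclidean space `ξ`, of
the orthogonal projections of `K₁, …, K_j` onto `ξ`. -/
def mixedProjectionVolume {n j : ℕ} (K : Fin j → ConvexBody (EuclideanSpace ℝ (Fin n)))
    (ξ : RealGrassmannian n j) : ℝ :=
  mixedVolume fun i => (K i).mapCLM ξ.1.orthogonalProjectionOnto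

/-- The mixed affine quermassintegral
`Φ_{n-j}(K₁, …, K_j) = ω_n [∫_{G_{n,j}} (vol_j((K₁, …, K_j) | ξ) / ω_j) ^ (-n) dμ_j(ξ)] ^ (-1/n)`.
It is computed in `[0, ∞]`, so that a subspace on which the mixed volume vanishes contributes the
value `0 ^ (-n) = ∞` to the integrand, and `∞ ^ (-1/n) = 0`. -/
def mixedAffineQuermassintegral {n j : ℕ} (hj : j ≤ n)
    (K : Fin j → ConvexBody (EuclideanSpace ℝ (Fin n))) : ENNReal :=
  unitBallVolume n *
    (∫⁻ ξ, (ENNReal.ofReal (mixedProjectionVolume K ξ) / unitBallVolume j) ^ (-(n : ℝ))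
      ∂(RealGrassmannian.haar hj)) ^ (-(1 / (n : ℝ)))

/-- The image `g K` of a convex body of `ℝ^n` under `g ∈ SL(n)`. -/
def ConvexBody.slImage {n : ℕ} (g : Matrix.SpecialLinearGroup (Fin n) ℝ)
    (K : ConvexBody (EuclideanSpace ℝ (Fin n))) : ConvexBody (EuclideanSpace ℝ (Fin n)) :=
  K.mapCLM (Matrix.toEuclideanCLM (n := Fin n) (𝕜 := ℝ) g.1)

end

/-! Write an orthonormal basis of ξ as the columns of an n × j matrix X. Up to an isometry the
projection onto ξ is x ↦ Xᵀx, so the mixed projection volume is f(X), where f = `frameVolume K`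
makes sense for every matrix X. Two rules govern f: f(XT) = |det T| f(X), and passing from K to gK
replaces X by gᵀX.

Put G = (f/ω_j)^(-n), so that G(XT) = |det T|^(-n) G(X). The exponent -n exactly cancels the
Jacobian |det T|^n of X ↦ XT, so the measure G(X) dX is invariant under GL(j) acting on the right.
The Grassmannian integral is, up to a constant, the mass of this measure modulo GL(j). Left
multiplication by a matrix of determinant ±1 preserves dX and commutes with GL(j), hence does not
change that mass.

The quotient is handled by a cutoff χ that depends only on XᵀX. `lintegral_mul_frameCutoff`
identifies ∫ G χ dX with the average of G over orthonormal frames, times a finite nonzero constant.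
`cutoffMass_mul_lintegral` shows that ∫ G(X) χ(AX) dX is the same for all invertible A, by Fubini
over frames and GL(j). Everything takes place in [0, ∞], so G may be infinite and its integral may
diverge. -/

noncomputable section

open scoped Matrix

/-! ### Linear images of convex bodies and of mixed volumes -/

namespace ConvexBody

section mapCLM

variable {U V W : Type*} [NormedAddCommGroup U] [NormedSpace ℝ U] [NormedAddCommGroup V]
  [NormedSpace ℝ V] [NormedAddCommGroup W] [NormedSpace ℝ W]

theorem coe_mapCLM (f : V →L[ℝ] W) (K : ConvexBody V) : (K.mapCLM f : Set W) = f '' (K : Set V) :=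
  rfl

theorem mapCLM_mapCLM (f : V →L[ℝ] W) (g : U →L[ℝ] V) (K : ConvexBody U) :
    (K.mapCLM g).mapCLM f = K.mapCLM (f.comp g) := by
  apply SetLike.coe_injective
  simp only [coe_mapCLM, Set.image_image]
  rfl

theorem mapCLM_sum {ι : Type*} (f : V →L[ℝ] W) (K : ι → ConvexBody V) (s : Finset ι) :
    (∑ i ∈ s, K i).mapCLM f = ∑ i ∈ s, (K i).mapCLM f := by
  classical
  induction s using Finset.induction_on with
  | empty =>
    apply SetLike.coe_injective
    simp [coe_mapCLM, ConvexBody.coe_zero, Set.singleton_zero]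
  | insert a s ha ih =>
    rw [Finset.sum_insert ha, Finset.sum_insert ha, ← ih]
    apply SetLike.coe_injective
    simp [coe_mapCLM, Set.image_add]

end mapCLM

end ConvexBody

/-- Linear maps commute with Minkowski sums, so every volume in the polarization formula acquires
the same factor. -/
theorem mixedVolume_mapCLM {E F : Type*} [NormedAddCommGroup E] [InnerProductSpace ℝ E]
    [FiniteDimensional ℝ E] [MeasurableSpace E] [BorelSpace E] [NormedAddCommGroup F]
    [InnerProductSpace ℝ F] [FiniteDimensional ℝ F] [MeasurableSpace F] [BorelSpace F] {j : ℕ}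
    (f : E →L[ℝ] F) (c : ℝ)
    (hf : ∀ s : Set E, (volume : Measure F).real (f '' s) = c * (volume : Measure E).real s)
    (K : Fin j → ConvexBody E) :
    mixedVolume (fun i => (K i).mapCLM f) = c * mixedVolume K := by
  simp only [mixedVolume, ← ConvexBody.mapCLM_sum, ConvexBody.coe_mapCLM, hf]
  simp only [Finset.mul_sum]
  exact Finset.sum_congr rfl fun S _ => by ring

/-! ### Mixed volumes as functions of a frame -/

section frames

variable {n j : ℕ}

/-- The linear map `x ↦ Xᵀ x`, whose coordinates are the inner products with the columns of `X`. -/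
def frameMap (X : Matrix (Fin n) (Fin j) ℝ) :
    EuclideanSpace ℝ (Fin n) →L[ℝ] EuclideanSpace ℝ (Fin j) :=
  LinearMap.toContinuousLinearMap (Matrix.toEuclideanLin Xᵀ)

theorem frameMap_apply (X : Matrix (Fin n) (Fin j) ℝ) (x : EuclideanSpace ℝ (Fin n)) :
    frameMap X x = WithLp.toLp 2 (Matrix.mulVec Xᵀ x.ofLp) := rfl

/-- The mixed volume in `ℝ^j` of the images of the bodies under `Xᵀ`. -/
def frameVolume (K : Fin j → ConvexBody (EuclideanSpace ℝ (Fin n)))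
    (X : Matrix (Fin n) (Fin j) ℝ) : ℝ :=
  mixedVolume fun i => (K i).mapCLM (frameMap X)

theorem frameVolume_mul (K : Fin j → ConvexBody (EuclideanSpace ℝ (Fin n)))
    (X : Matrix (Fin n) (Fin j) ℝ) (T : Matrix (Fin j) (Fin j) ℝ) :
    frameVolume K (X * T) = |T.det| * frameVolume K X := by
  have h : frameMap (X * T) = (frameMap T).comp (frameMap X) := by
    ext x k
    simp [frameMap_apply, Matrix.transpose_mul]
  rw [frameVolume, h]
  simp only [← ConvexBody.mapCLM_mapCLM]
  refine mixedVolume_mapCLM _ _ (fun s => ?_) _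
  have h2 : LinearMap.det (Matrix.toEuclideanLin Tᵀ) = T.det := by
    rw [Matrix.toEuclideanLin, LinearMap.det_toLpLin, Matrix.det_transpose]
  have := Measure.addHaar_image_linearMap (volume : Measure (EuclideanSpace ℝ (Fin j)))
    (Matrix.toEuclideanLin Tᵀ) s
  rw [h2] at this
  simp only [Measure.real]
  rw [show (frameMap T '' s) = Matrix.toEuclideanLin Tᵀ '' s from rfl, this]
  simp

theorem frameVolume_slImage (K : Fin j → ConvexBody (EuclideanSpace ℝ (Fin n)))
    (g : Matrix.SpecialLinearGroup (Fin n) ℝ) (X : Matrix (Fin n) (Fin j) ℝ) :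
    frameVolume (fun i => (K i).slImage g) X = frameVolume K (g.1ᵀ * X) := by
  have h : frameMap (g.1ᵀ * X) =
      (frameMap X).comp (Matrix.toEuclideanCLM (n := Fin n) (𝕜 := ℝ) g.1) := by
    ext x k
    simp [frameMap_apply, Matrix.transpose_mul]
  simp only [frameVolume, ConvexBody.slImage, ConvexBody.mapCLM_mapCLM, h]

instance : MeasurableSpace (Matrix (Fin n) (Fin j) ℝ) :=
  inferInstanceAs (MeasurableSpace (Fin n → Fin j → ℝ))

instance : BorelSpace (Matrix (Fin n) (Fin j) ℝ) :=
  inferInstanceAs (BorelSpace (Fin n → Fin j → ℝ))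

instance : SecondCountableTopology (Matrix (Fin n) (Fin j) ℝ) :=
  inferInstanceAs (SecondCountableTopology (Fin n → Fin j → ℝ))

instance : PolishSpace (Matrix (Fin n) (Fin j) ℝ) :=
  inferInstanceAs (PolishSpace (Fin n → Fin j → ℝ))

instance : MeasureSpace (Matrix (Fin n) (Fin j) ℝ) :=
  inferInstanceAs (MeasureSpace (Fin n → Fin j → ℝ))

instance : SigmaFinite (volume : Measure (Matrix (Fin n) (Fin j) ℝ)) :=
  inferInstanceAs (SigmaFinite (volume : Measure (Fin n → Fin j → ℝ)))

instance : IsFiniteMeasureOnCompacts (volume : Measure (Matrix (Fin n) (Fin j) ℝ)) :=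
  inferInstanceAs (IsFiniteMeasureOnCompacts (volume : Measure (Fin n → Fin j → ℝ)))

instance : (volume : Measure (Matrix (Fin n) (Fin j) ℝ)).IsOpenPosMeasure :=
  inferInstanceAs ((volume : Measure (Fin n → Fin j → ℝ)).IsOpenPosMeasure)

/-- The set is the projection, along the compact factor s, of the closed set of triples (X, y, x)
with Xᵀx = y. Closedness makes the volumes of its slices measurable in X. -/
theorem isClosed_setOf_mem_frameMap_image {s : Set (EuclideanSpace ℝ (Fin n))} (hs : IsCompact s) :
    IsClosed {p : Matrix (Fin n) (Fin j) ℝ × EuclideanSpace ℝ (Fin j) |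
      p.2 ∈ frameMap p.1 '' s} := by
  have hc : Continuous fun q : (Matrix (Fin n) (Fin j) ℝ × EuclideanSpace ℝ (Fin j)) × s =>
      frameMap q.1.1 q.2.1 := by
    simp only [frameMap_apply]
    fun_prop
  have h1 := isClosed_eq hc (continuous_fst.snd)
  have : CompactSpace s := isCompact_iff_compactSpace.mp hs
  have h2 := isClosedMap_fst_of_compactSpace _ h1
  convert h2 using 1
  ext p
  constructor
  · rintro ⟨x, hx, hxp⟩
    exact ⟨(p, ⟨x, hx⟩), hxp, rfl⟩
  · rintro ⟨⟨q, x⟩, hq, rfl⟩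
    exact ⟨x.1, x.2, hq⟩

theorem measurable_volume_frameMap_image {s : Set (EuclideanSpace ℝ (Fin n))} (hs : IsCompact s) :
    Measurable fun X : Matrix (Fin n) (Fin j) ℝ => volume (frameMap X '' s) :=
  measurable_measure_prodMk_left (isClosed_setOf_mem_frameMap_image hs).measurableSet

theorem measurable_frameVolume (K : Fin j → ConvexBody (EuclideanSpace ℝ (Fin n))) :
    Measurable (frameVolume K) := by
  unfold frameVolume mixedVolume
  simp only [← ConvexBody.mapCLM_sum, ConvexBody.coe_mapCLM]
  refine measurable_const.mul (Finset.measurable_sum _ fun S _ => measurable_const.mul ?_)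
  exact (measurable_volume_frameMap_image (ConvexBody.isCompact _)).ennreal_toReal

/-- The matrix whose columns are the first `j` standard basis vectors of `ℝ^n`. -/
def coordinateFrame (hj : j ≤ n) : Matrix (Fin n) (Fin j) ℝ :=
  (1 : Matrix (Fin n) (Fin n) ℝ).submatrix id (Fin.castLE hj)

theorem coordinateFrame_gram (hj : j ≤ n) :
    (coordinateFrame hj)ᵀ * coordinateFrame hj = 1 := by
  ext a b
  simp [coordinateFrame, Matrix.mul_apply, Matrix.one_apply, Fin.castLE_inj]

/-- If the columns of `X` are an orthonormal basis of `ξ`, the projection onto `ξ` is `Xᵀ` up to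
an isometry. -/
theorem mixedProjectionVolume_eq_frameVolume
    (K : Fin j → ConvexBody (EuclideanSpace ℝ (Fin n))) (ξ : RealGrassmannian n j)
    (X : Matrix (Fin n) (Fin j) ℝ) (hX : Xᵀ * X = 1)
    (hξ : ∀ k, WithLp.toLp 2 (X.col k) ∈ ξ.1) :
    mixedProjectionVolume K ξ = frameVolume K X := by
  let v : Fin j → ξ.1 := fun k => ⟨WithLp.toLp 2 (X.col k), hξ k⟩
  have hv : Orthonormal ℝ v := by
    rw [orthonormal_iff_ite]
    intro a b
    have := congrFun (congrFun hX b) a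
    simp only [Matrix.mul_apply, Matrix.transpose_apply, Matrix.one_apply] at this
    simp only [v, Submodule.coe_inner, PiLp.inner_apply, Matrix.col_apply]
    simp only [eq_comm (a := a)]
    rw [← this]
    simp
  have hspan : ⊤ ≤ Submodule.span ℝ (Set.range v) := by
    rw [hv.linearIndependent.span_eq_top_of_card_eq_finrank' (by simp [ξ.2])]
  let b := OrthonormalBasis.mk hv hspan
  have hb : ∀ k, (b k : EuclideanSpace ℝ (Fin n)) = WithLp.toLp 2 (X.col k) := fun k => by
    simp [b, v]
  -- Xᵀx lists the inner products of x with the basis `b`, which are the coordinates of the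
  -- projection of x in that basis.
  have h : frameMap X = (b.repr.toContinuousLinearEquiv : ξ.1 →L[ℝ] _).comp
      ξ.1.orthogonalProjectionOnto := by
    ext x k
    simp only [ContinuousLinearMap.comp_apply, frameMap_apply]
    change _ = b.repr _ k
    rw [OrthonormalBasis.repr_apply_apply,
      Submodule.inner_orthogonalProjectionOnto_eq_of_mem_left, hb]
    simp [PiLp.inner_apply, Matrix.mulVec, dotProduct, mul_comm]
  rw [frameVolume, h]
  simp only [← ConvexBody.mapCLM_mapCLM]
  rw [mixedVolume_mapCLM _ 1, one_mul]; rfl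
  intro s
  rw [one_mul]
  have := b.repr.symm.measurePreserving.measure_preimage_emb
    b.repr.symm.toHomeomorph.measurableEmbedding s
  rw [Measure.real, Measure.real, ← this]
  congr 2
  exact b.repr.toEquiv.image_eq_preimage_symm s

end frames

/-! ### From the Grassmannian to the orthogonal group -/

section grassmannian

variable {n j : ℕ}

theorem orthogonalIsometry_apply (U : Matrix.orthogonalGroup (Fin n) ℝ)
    (x : EuclideanSpace ℝ (Fin n)) :
    orthogonalIsometry U x = WithLp.toLp 2 (U.1 *ᵥ x.ofLp) := rfl

theorem Matrix.orthogonalGroup.transpose_mul_self (U : Matrix.orthogonalGroup (Fin n) ℝ) :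
    U.1ᵀ * U.1 = 1 :=
  (Matrix.mem_orthogonalGroup_iff' (Fin n) ℝ).mp U.2

theorem gram_orthogonal_mul (U : Matrix.orthogonalGroup (Fin n) ℝ)
    (X : Matrix (Fin n) (Fin j) ℝ) : (U.1 * X)ᵀ * (U.1 * X) = Xᵀ * X := by
  rw [Matrix.transpose_mul, Matrix.mul_assoc, ← Matrix.mul_assoc U.1ᵀ,
    Matrix.orthogonalGroup.transpose_mul_self, Matrix.one_mul]

theorem mul_coordinateFrame_apply (hj : j ≤ n) (A : Matrix (Fin n) (Fin n) ℝ) (i : Fin n)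
    (k : Fin j) : (A * coordinateFrame hj) i k = A i (Fin.castLE hj k) := by
  simp [coordinateFrame, Matrix.mul_apply, Matrix.one_apply]

theorem exists_orthogonal_mul_coordinateFrame (hj : j ≤ n) (Q : Matrix (Fin n) (Fin j) ℝ)
    (hQ : Qᵀ * Q = 1) :
    ∃ V : Matrix.orthogonalGroup (Fin n) ℝ, V.1 * coordinateFrame hj = Q := by
  let v : Fin n → EuclideanSpace ℝ (Fin n) := fun i =>
    if h : (i : ℕ) < j then WithLp.toLp 2 (Q.col ⟨i, h⟩) else 0
  let s : Set (Fin n) := {i | (i : ℕ) < j}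
  have hv : Orthonormal ℝ (s.domRestrict v) := by
    rw [orthonormal_iff_ite]
    rintro ⟨a, ha⟩ ⟨b, hb⟩
    have ha' : (a : ℕ) < j := ha
    have hb' : (b : ℕ) < j := hb
    have := congrFun (congrFun hQ ⟨b, hb'⟩) ⟨a, ha'⟩
    simp only [Matrix.mul_apply, Matrix.transpose_apply, Matrix.one_apply, Fin.mk.injEq] at this
    simp only [Set.domRestrict_apply, v, ha', hb', dif_pos, PiLp.inner_apply, Matrix.col_apply,
      Subtype.mk.injEq, Fin.ext_iff]
    simp only [eq_comm (a := (a : ℕ))]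
    rw [← this]
    simp
  obtain ⟨b, hb⟩ := hv.exists_orthonormalBasis_extension_of_card_eq (by simp)
  let A : Matrix (Fin n) (Fin n) ℝ := Matrix.of fun i k => b k i
  have hA : A ∈ Matrix.orthogonalGroup (Fin n) ℝ := by
    rw [Matrix.mem_orthogonalGroup_iff']
    ext i k
    have := orthonormal_iff_ite.mp b.orthonormal i k
    simp only [PiLp.inner_apply] at this
    rw [Matrix.one_apply, ← this]
    simp [Matrix.mul_apply, A, mul_comm]
  refine ⟨⟨A, hA⟩, ?_⟩
  ext i k
  rw [mul_coordinateFrame_apply]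
  simp only [A, Matrix.of_apply]
  have hk : ((Fin.castLE hj k : Fin n) : ℕ) < j := k.2
  rw [hb _ hk]
  simp [v]

namespace RealGrassmannian

theorem toSubmodule_injective :
    Function.Injective (toSubmodule : RealGrassmannian n j → _) := by
  rintro ⟨a, ha⟩ ⟨b, hb⟩ h
  cases h
  rfl

theorem col_mem_rotate_coordinate (hj : j ≤ n) (U : Matrix.orthogonalGroup (Fin n) ℝ) (k : Fin j) :
    WithLp.toLp 2 ((U.1 * coordinateFrame hj).col k) ∈ (rotate U (coordinate hj)).1 := by
  refine ⟨EuclideanSpace.basisFun (Fin n) ℝ (Fin.castLE hj k), Submodule.subset_span ⟨k, rfl⟩, ?_⟩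
  change orthogonalIsometry U _ = _
  rw [orthogonalIsometry_apply]
  ext i
  simp [mul_coordinateFrame_apply]

theorem rotate_coordinate_surjective (hj : j ≤ n) :
    Function.Surjective fun U : Matrix.orthogonalGroup (Fin n) ℝ =>
      rotate U (coordinate hj) := by
  intro ξ
  let b : OrthonormalBasis (Fin j) ℝ ξ.1 :=
    (stdOrthonormalBasis ℝ ξ.1).reindex (finCongr ξ.2)
  let Q : Matrix (Fin n) (Fin j) ℝ := Matrix.of fun i k => (b k : EuclideanSpace ℝ (Fin n)) i
  have hQ : Qᵀ * Q = 1 := by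
    ext i k
    have := orthonormal_iff_ite.mp b.orthonormal i k
    simp only [Submodule.coe_inner, PiLp.inner_apply] at this
    rw [Matrix.one_apply, ← this]
    simp [Matrix.mul_apply, Q, mul_comm]
  obtain ⟨V, hV⟩ := exists_orthogonal_mul_coordinateFrame hj Q hQ
  refine ⟨V, toSubmodule_injective (Submodule.eq_of_le_of_finrank_eq ?_ ?_)⟩
  · change Submodule.map _ (Submodule.span ℝ _) ≤ _
    rw [Submodule.map_span, Submodule.span_le]
    rintro _ ⟨_, ⟨k, rfl⟩, rfl⟩
    have h : orthogonalIsometry V (EuclideanSpace.basisFun (Fin n) ℝ (Fin.castLE hj k)) = b k := by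
      rw [orthogonalIsometry_apply]
      ext i
      have := congrFun (congrFun hV i) k
      rw [mul_coordinateFrame_apply] at this
      simpa [Q] using this
    change orthogonalIsometry V _ ∈ ξ.1
    rw [h]
    exact (b k).2
  · rw [ξ.2, (rotate V (coordinate hj)).2]

instance : SecondCountableTopology (RealGrassmannian n j) :=
  TopologicalSpace.secondCountableTopology_induced _ _ _

instance : T0Space (RealGrassmannian n j) := by
  have h : Topology.IsInducing fun ξ : RealGrassmannian n j => ξ.1.starProjection := ⟨rfl⟩
  refine (Topology.IsEmbedding.mk h fun a b hab => toSubmodule_injective ?_).t0Space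
  have := congrArg (fun f : EuclideanSpace ℝ (Fin n) →L[ℝ] _ => LinearMap.range f.toLinearMap) hab
  simpa using this

end RealGrassmannian

instance : PolishSpace (Matrix.orthogonalGroup (Fin n) ℝ) := by
  have h : CompactSpace (Matrix.orthogonalGroup (Fin n) ℝ) := inferInstance
  exact (isCompact_iff_compactSpace.mpr h).isClosed.polishSpace

theorem mixedProjectionVolume_rotate (hj : j ≤ n)
    (K : Fin j → ConvexBody (EuclideanSpace ℝ (Fin n))) (U : Matrix.orthogonalGroup (Fin n) ℝ) :
    mixedProjectionVolume K (RealGrassmannian.rotate U (RealGrassmannian.coordinate hj)) =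
      frameVolume K (U.1 * coordinateFrame hj) :=
  mixedProjectionVolume_eq_frameVolume K _ _
    (by rw [gram_orthogonal_mul, coordinateFrame_gram])
    (RealGrassmannian.col_mem_rotate_coordinate hj U)

theorem continuous_orthogonal_mul :
    Continuous fun p : Matrix.orthogonalGroup (Fin n) ℝ × Matrix (Fin n) (Fin j) ℝ =>
      p.1.1 * p.2 :=
  (continuous_subtype_val.comp continuous_fst).matrix_mul continuous_snd

theorem measurable_orthogonal_mul (X : Matrix (Fin n) (Fin j) ℝ) :
    Measurable fun U : Matrix.orthogonalGroup (Fin n) ℝ => U.1 * X :=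
  (continuous_orthogonal_mul.comp (continuous_id.prodMk continuous_const)).measurable

/-- Measurability descends along the surjection U ↦ Uξ₀ from a Polish space onto a second countable
T0 space, so it suffices to check it on the orthogonal group, where the function is explicit. -/
theorem measurable_mixedProjectionVolume (hj : j ≤ n)
    (K : Fin j → ConvexBody (EuclideanSpace ℝ (Fin n))) :
    Measurable (mixedProjectionVolume K) := by
  rw [← (RealGrassmannian.continuous_rotate _).measurable.measurable_comp_iff_of_surjective
    (RealGrassmannian.rotate_coordinate_surjective hj)]
  have h : mixedProjectionVolume K ∘ (fun U => RealGrassmannian.rotate U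
      (RealGrassmannian.coordinate hj)) = fun U => frameVolume K (U.1 * coordinateFrame hj) :=
    funext fun U => mixedProjectionVolume_rotate hj K U
  rw [h]
  exact (measurable_frameVolume K).comp (measurable_orthogonal_mul _)

theorem lintegral_haar_mixedProjectionVolume (hj : j ≤ n)
    (K : Fin j → ConvexBody (EuclideanSpace ℝ (Fin n))) {f : ℝ → ENNReal} (hf : Measurable f) :
    ∫⁻ ξ, f (mixedProjectionVolume K ξ) ∂(RealGrassmannian.haar hj) =
      ∫⁻ U, f (frameVolume K (U.1 * coordinateFrame hj)) ∂(orthogonalHaar n) := by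
  rw [RealGrassmannian.haar, lintegral_map
    (show Measurable fun ξ => f (mixedProjectionVolume K ξ) from
      hf.comp (measurable_mixedProjectionVolume hj K))
    (RealGrassmannian.continuous_rotate _).measurable]
  simp only [mixedProjectionVolume_rotate]

instance : IsProbabilityMeasure (orthogonalHaar n) := ⟨by
  simpa [orthogonalHaar] using Measure.haarMeasure_self
    (K₀ := (⊤ : TopologicalSpace.PositiveCompacts (Matrix.orthogonalGroup (Fin n) ℝ)))⟩

instance : (orthogonalHaar n).IsHaarMeasure :=
  inferInstanceAs (Measure.haarMeasure _).IsHaarMeasure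

/-- A right translate of Haar measure is again a Haar probability measure, hence the same one by
uniqueness. -/
theorem lintegral_orthogonalHaar_mul_right {f : Matrix.orthogonalGroup (Fin n) ℝ → ENNReal}
    (hf : Measurable f) (V : Matrix.orthogonalGroup (Fin n) ℝ) :
    ∫⁻ U, f (U * V) ∂(orthogonalHaar n) = ∫⁻ U, f U ∂(orthogonalHaar n) := by
  have hm : Measurable fun U : Matrix.orthogonalGroup (Fin n) ℝ => U * V :=
    (continuous_mul_const V).measurable
  have : IsProbabilityMeasure ((orthogonalHaar n).map (· * V)) :=
    Measure.isProbabilityMeasure_map hm.aemeasurable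
  have h : (orthogonalHaar n).map (· * V) = orthogonalHaar n :=
    Measure.isHaarMeasure_eq_of_isProbabilityMeasure _ _
  rw [← lintegral_map hf hm, h]

end grassmannian

/-! ### Lebesgue measure on matrices and Haar measure on GL(j) -/

section lebesgue

variable {n j : ℕ}

theorem lintegral_comp_linearMap {E : Type*} [NormedAddCommGroup E] [NormedSpace ℝ E]
    [MeasurableSpace E] [BorelSpace E] [FiniteDimensional ℝ E] (μ : Measure E)
    [μ.IsAddHaarMeasure] {f : E →ₗ[ℝ] E} (hf : LinearMap.det f ≠ 0) {F : E → ENNReal}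
    (hF : Measurable F) :
    ∫⁻ x, F (f x) ∂μ = ENNReal.ofReal |LinearMap.det f|⁻¹ * ∫⁻ x, F x ∂μ := by
  rw [← lintegral_map hF f.continuous_of_finiteDimensional.measurable,
    Measure.map_linearMap_addHaar_eq_smul_addHaar μ hf, lintegral_smul_measure, abs_inv,
    smul_eq_mul]

/-- Right multiplication acts on each of the n rows by Tᵀ, so its determinant is (det T)^n. -/
theorem lintegral_matrix_mul_right {F : Matrix (Fin n) (Fin j) ℝ → ENNReal} (hF : Measurable F)
    {T : Matrix (Fin j) (Fin j) ℝ} (hT : T.det ≠ 0) :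
    ∫⁻ X : Matrix (Fin n) (Fin j) ℝ, F (X * T) =
      ENNReal.ofReal (|T.det|⁻¹ ^ n) * ∫⁻ X, F X := by
  let L : (Fin n → Fin j → ℝ) →ₗ[ℝ] (Fin n → Fin j → ℝ) :=
    LinearMap.pi fun i => (Matrix.toLin' Tᵀ).comp (LinearMap.proj i)
  have hdet : LinearMap.det L = T.det ^ n := by
    simp [L, LinearMap.det_pi]
  have h := lintegral_comp_linearMap (volume : Measure (Fin n → Fin j → ℝ)) (f := L)
    (by rw [hdet]; exact pow_ne_zero _ hT) hF
  rw [hdet, abs_pow, ← inv_pow] at h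
  refine Eq.trans (lintegral_congr fun X => congrArg F ?_) h
  ext i k
  change _ = (Tᵀ *ᵥ X i) k
  simp [Matrix.mul_apply, Matrix.mulVec, dotProduct, mul_comm]

theorem lintegral_matrix_mul_left {F : Matrix (Fin n) (Fin j) ℝ → ENNReal} (hF : Measurable F)
    {A : Matrix (Fin n) (Fin n) ℝ} (hA : A.det ≠ 0) :
    ∫⁻ X : Matrix (Fin n) (Fin j) ℝ, F (A * X) =
      ENNReal.ofReal (|A.det|⁻¹ ^ j) * ∫⁻ X, F X := by
  let L : (Fin j → Fin n → ℝ) →ₗ[ℝ] (Fin j → Fin n → ℝ) :=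
    LinearMap.pi fun i => (Matrix.toLin' A).comp (LinearMap.proj i)
  have hdet : LinearMap.det L = A.det ^ j := by
    simp [L, LinearMap.det_pi]
  -- Left multiplication acts on the j columns separately; conjugating by the transpose turns
  -- columns into rows and keeps the determinant.
  let e : (Fin j → Fin n → ℝ) ≃ₗ[ℝ] (Fin n → Fin j → ℝ) :=
    Matrix.transposeLinearEquiv (Fin j) (Fin n) ℝ ℝ
  let L' : (Fin n → Fin j → ℝ) →ₗ[ℝ] (Fin n → Fin j → ℝ) :=
    (e : (Fin j → Fin n → ℝ) →ₗ[ℝ] _) ∘ₗ L ∘ₗ (e.symm : _ →ₗ[ℝ] (Fin j → Fin n → ℝ))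
  have hdet' : LinearMap.det L' = A.det ^ j := by
    rw [← hdet]
    exact LinearMap.det_conj L e
  have h := lintegral_comp_linearMap (volume : Measure (Fin n → Fin j → ℝ)) (f := L')
    (by rw [hdet']; exact pow_ne_zero _ hA) hF
  rw [hdet', abs_pow, ← inv_pow] at h
  refine Eq.trans (lintegral_congr fun X => congrArg F ?_) h
  ext i k
  change _ = (A *ᵥ fun l => X l k) i
  simp [Matrix.mul_apply, Matrix.mulVec, dotProduct]

theorem abs_det_orthogonal (U : Matrix.orthogonalGroup (Fin n) ℝ) : |U.1.det| = 1 := by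
  have h := congrArg Matrix.det (Matrix.orthogonalGroup.transpose_mul_self U)
  rw [Matrix.det_mul, Matrix.det_transpose, Matrix.det_one] at h
  rcases mul_self_eq_one_iff.mp h with h | h <;> simp [h]

theorem lintegral_matrix_mul_left_of_abs_det_eq_one {F : Matrix (Fin n) (Fin j) ℝ → ENNReal}
    (hF : Measurable F) {A : Matrix (Fin n) (Fin n) ℝ} (hA : |A.det| = 1) :
    ∫⁻ X : Matrix (Fin n) (Fin j) ℝ, F (A * X) = ∫⁻ X, F X := by
  rw [lintegral_matrix_mul_left hF (by rintro h; simp [h] at hA), hA]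
  simp

theorem continuous_det_matrix :
    Continuous fun T : Matrix (Fin j) (Fin j) ℝ => T.det := continuous_id.matrix_det

/-- The measure `|det T| ^ (-j) dT`, that is, Haar measure on `GL(j)`. -/
def haarGL (j : ℕ) : Measure (Matrix (Fin j) (Fin j) ℝ) :=
  volume.withDensity fun T => ENNReal.ofReal (|T.det|⁻¹ ^ j)

theorem measurable_haarGL_density :
    Measurable fun T : Matrix (Fin j) (Fin j) ℝ => ENNReal.ofReal (|T.det|⁻¹ ^ j) :=
  ((continuous_det_matrix.abs.measurable).inv.pow_const j).ennreal_ofReal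

instance : SigmaFinite (haarGL j) := by
  unfold haarGL
  infer_instance

theorem ae_haarGL_det_ne_zero : ∀ᵐ T ∂(haarGL j), T.det ≠ 0 := by
  rw [haarGL, ae_withDensity_iff measurable_haarGL_density]
  -- For j > 0 the density itself vanishes at singular matrices, because 0⁻¹ = 0. For j = 0 the
  -- determinant is 1.
  refine Filter.Eventually.of_forall fun T hT h => hT ?_
  rcases Nat.eq_zero_or_pos j with rfl | hj
  · simp at h
  · simp [h, hj.ne']

theorem lintegral_haarGL {F : Matrix (Fin j) (Fin j) ℝ → ENNReal} (hF : Measurable F) :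
    ∫⁻ T, F T ∂(haarGL j) = ∫⁻ T, ENNReal.ofReal (|T.det|⁻¹ ^ j) * F T := by
  rw [haarGL, lintegral_withDensity_eq_lintegral_mul _ measurable_haarGL_density hF]
  rfl

theorem ofReal_abs_inv_pow_ne_zero {d : ℝ} (hd : d ≠ 0) (k : ℕ) :
    ENNReal.ofReal (|d|⁻¹ ^ k) ≠ 0 := by
  have := abs_pos.mpr hd
  exact (ENNReal.ofReal_pos.mpr (by positivity)).ne'

theorem ofReal_abs_mul_inv_pow (a b : ℝ) (k : ℕ) :
    ENNReal.ofReal (|a * b|⁻¹ ^ k) =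
      ENNReal.ofReal (|a|⁻¹ ^ k) * ENNReal.ofReal (|b|⁻¹ ^ k) := by
  rw [← ENNReal.ofReal_mul (by positivity), ← mul_pow, abs_mul, mul_inv]

/-- The density picks up |det M|^(-j), which is also the Jacobian factor of the substitution. The
factor is the same for left multiplication: GL(j) is unimodular. -/
theorem lintegral_haarGL_mul_right {F : Matrix (Fin j) (Fin j) ℝ → ENNReal} (hF : Measurable F)
    {M : Matrix (Fin j) (Fin j) ℝ} (hM : M.det ≠ 0) :
    ∫⁻ T, F (T * M) ∂(haarGL j) = ∫⁻ T, F T ∂(haarGL j) := by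
  have hc : Measurable fun T : Matrix (Fin j) (Fin j) ℝ => T * M :=
    (continuous_id.matrix_mul continuous_const).measurable
  have hFc : Measurable fun T : Matrix (Fin j) (Fin j) ℝ => F (T * M) := hF.comp hc
  have h := lintegral_matrix_mul_right (measurable_haarGL_density.mul hF) hM
  rw [lintegral_haarGL hF, lintegral_haarGL hFc]
  simp only [Pi.mul_apply, Matrix.det_mul, ofReal_abs_mul_inv_pow,
    mul_comm _ (ENNReal.ofReal (|M.det|⁻¹ ^ j)), mul_assoc] at h
  rw [lintegral_const_mul' _ _ ENNReal.ofReal_ne_top] at h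
  exact (ENNReal.mul_right_inj (ofReal_abs_inv_pow_ne_zero hM j) ENNReal.ofReal_ne_top).mp h

theorem lintegral_haarGL_mul_left {F : Matrix (Fin j) (Fin j) ℝ → ENNReal} (hF : Measurable F)
    {M : Matrix (Fin j) (Fin j) ℝ} (hM : M.det ≠ 0) :
    ∫⁻ T, F (M * T) ∂(haarGL j) = ∫⁻ T, F T ∂(haarGL j) := by
  have hc : Measurable fun T : Matrix (Fin j) (Fin j) ℝ => M * T :=
    (continuous_const.matrix_mul continuous_id).measurable
  have hFc : Measurable fun T : Matrix (Fin j) (Fin j) ℝ => F (M * T) := hF.comp hc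
  have h := lintegral_matrix_mul_left (measurable_haarGL_density.mul hF) hM
  rw [lintegral_haarGL hF, lintegral_haarGL hFc]
  simp only [Pi.mul_apply, Matrix.det_mul, ofReal_abs_mul_inv_pow, mul_assoc] at h
  rw [lintegral_const_mul' _ _ ENNReal.ofReal_ne_top] at h
  exact (ENNReal.mul_right_inj (ofReal_abs_inv_pow_ne_zero hM j) ENNReal.ofReal_ne_top).mp h

theorem gram_mul (X : Matrix (Fin n) (Fin j) ℝ) (T : Matrix (Fin j) (Fin j) ℝ) :
    (X * T)ᵀ * (X * T) = Tᵀ * (Xᵀ * X) * T := by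
  simp only [Matrix.transpose_mul, Matrix.mul_assoc]

open scoped MatrixOrder in
-- Factor the Gram matrix as XᵀX = SᵀS. Then XS⁻¹ has orthonormal columns, which extend to an
-- orthogonal matrix.
theorem exists_eq_orthogonal_mul_coordinateFrame_mul (hj : j ≤ n) {X : Matrix (Fin n) (Fin j) ℝ}
    (hX : (Xᵀ * X).det ≠ 0) :
    ∃ (V : Matrix.orthogonalGroup (Fin n) ℝ) (S : Matrix (Fin j) (Fin j) ℝ),
      S.det ≠ 0 ∧ X = V.1 * (coordinateFrame hj * S) := by
  have hpos : 0 ≤ Xᵀ * X :=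
    Matrix.nonneg_iff_posSemidef.mpr (Matrix.posSemidef_conjTranspose_mul_self X)
  obtain ⟨S, hS⟩ := CStarAlgebra.nonneg_iff_eq_star_mul_self.mp hpos
  replace hS : Xᵀ * X = Sᵀ * S := hS
  have hdet : S.det ≠ 0 := by
    rintro h
    rw [hS, Matrix.det_mul, h, mul_zero] at hX
    exact hX rfl
  have hu : IsUnit S.det := isUnit_iff_ne_zero.mpr hdet
  obtain ⟨V, hV⟩ := exists_orthogonal_mul_coordinateFrame hj (X * S⁻¹) (by
    rw [gram_mul, hS, Matrix.mul_assoc, Matrix.mul_assoc, Matrix.mul_nonsing_inv _ hu,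
      Matrix.mul_one, ← Matrix.transpose_mul, Matrix.mul_nonsing_inv _ hu, Matrix.transpose_one])
  refine ⟨V, S, hdet, ?_⟩
  rw [← Matrix.mul_assoc, hV, Matrix.mul_assoc, Matrix.nonsing_inv_mul _ hu, Matrix.mul_one]

end lebesgue

/-! ### Cutoff functions and averaging over GL(j) -/

section averaging

variable {n j : ℕ}

/-- The indicator of a bounded open set of frames, bounded away from the degenerate ones and
described in terms of the Gram matrix. -/
def frameCutoff (X : Matrix (Fin n) (Fin j) ℝ) : ENNReal :=
  {X : Matrix (Fin n) (Fin j) ℝ |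
    1 / 2 < (Xᵀ * X).det ∧ (Xᵀ * X).trace < j + 1}.indicator 1 X

theorem isOpen_frameCutoff_support : IsOpen {X : Matrix (Fin n) (Fin j) ℝ |
    1 / 2 < (Xᵀ * X).det ∧ (Xᵀ * X).trace < j + 1} := by
  have hg : Continuous fun X : Matrix (Fin n) (Fin j) ℝ => Xᵀ * X :=
    continuous_id.matrix_transpose.matrix_mul continuous_id
  exact (isOpen_lt continuous_const hg.matrix_det).inter
    (isOpen_lt hg.matrix_trace continuous_const)

theorem measurable_frameCutoff :
    Measurable (frameCutoff : Matrix (Fin n) (Fin j) ℝ → ENNReal) :=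
  measurable_one.indicator isOpen_frameCutoff_support.measurableSet

theorem frameCutoff_congr {m : ℕ} {X : Matrix (Fin n) (Fin j) ℝ} {Y : Matrix (Fin m) (Fin j) ℝ}
    (h : Xᵀ * X = Yᵀ * Y) : frameCutoff X = frameCutoff Y := by
  simp only [frameCutoff, Set.indicator_apply, Set.mem_ofPred_eq, h, Pi.one_apply]

theorem frameCutoff_orthogonal_mul (U : Matrix.orthogonalGroup (Fin n) ℝ)
    (X : Matrix (Fin n) (Fin j) ℝ) : frameCutoff (U.1 * X) = frameCutoff X :=
  frameCutoff_congr (gram_orthogonal_mul U X)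

theorem det_gram_ne_zero_of_frameCutoff_ne_zero {X : Matrix (Fin n) (Fin j) ℝ}
    (h : frameCutoff X ≠ 0) : (Xᵀ * X).det ≠ 0 := by
  have := (Set.mem_of_indicator_ne_zero h).1
  intro h0
  rw [h0] at this
  norm_num at this

theorem det_gram_ne_zero_of_mul_left (A : Matrix (Fin n) (Fin n) ℝ)
    {X : Matrix (Fin n) (Fin j) ℝ} (h : ((A * X)ᵀ * (A * X)).det ≠ 0) : (Xᵀ * X).det ≠ 0 := by
  contrapose! h
  rw [← Matrix.exists_mulVec_eq_zero_iff] at h ⊢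
  obtain ⟨v, hv, h⟩ := h
  refine ⟨v, hv, ?_⟩
  have hX : X *ᵥ v = 0 := by
    have : X.conjTranspose * X = Xᵀ * X := by rw [Matrix.conjTranspose_eq_transpose_of_trivial]
    rwa [← this, Matrix.conjTranspose_mul_self_mulVec_eq_zero] at h
  rw [← Matrix.mulVec_mulVec, ← Matrix.mulVec_mulVec, hX]
  simp

theorem det_gram_mul_left_ne_zero {A : Matrix (Fin n) (Fin n) ℝ} (hA : A.det ≠ 0)
    {X : Matrix (Fin n) (Fin j) ℝ} (h : (Xᵀ * X).det ≠ 0) : ((A * X)ᵀ * (A * X)).det ≠ 0 := by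
  have hinv : A⁻¹ * (A * X) = X := by
    rw [← Matrix.mul_assoc, Matrix.nonsing_inv_mul _ (isUnit_iff_ne_zero.mpr hA), Matrix.one_mul]
  have h' : ((A⁻¹ * (A * X))ᵀ * (A⁻¹ * (A * X))).det ≠ 0 := by rwa [hinv]
  exact det_gram_ne_zero_of_mul_left A⁻¹ h'

theorem gram_orthogonal_mul_coordinateFrame_mul (hj : j ≤ n)
    (V : Matrix.orthogonalGroup (Fin n) ℝ) (S : Matrix (Fin j) (Fin j) ℝ) :
    (V.1 * (coordinateFrame hj * S))ᵀ * (V.1 * (coordinateFrame hj * S)) = Sᵀ * S := by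
  rw [gram_orthogonal_mul, gram_mul, coordinateFrame_gram, Matrix.mul_one]

/-- A frame of full rank has the same Gram matrices of right translates as an invertible matrix. -/
theorem exists_frameCutoff_mul_eq (hj : j ≤ n) {X : Matrix (Fin n) (Fin j) ℝ}
    (hX : (Xᵀ * X).det ≠ 0) :
    ∃ S : Matrix (Fin j) (Fin j) ℝ, S.det ≠ 0 ∧
      ∀ T : Matrix (Fin j) (Fin j) ℝ, frameCutoff (X * T) = frameCutoff (S * T) := by
  obtain ⟨V, S, hS, rfl⟩ := exists_eq_orthogonal_mul_coordinateFrame_mul hj hX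
  refine ⟨S, hS, fun T => frameCutoff_congr ?_⟩
  rw [gram_mul, gram_orthogonal_mul_coordinateFrame_mul, gram_mul]

/-- The integral of the cutoff with respect to the invariant measure on frames. -/
def cutoffMass (n j : ℕ) : ENNReal :=
  ∫⁻ X : Matrix (Fin n) (Fin j) ℝ, frameCutoff X *
    ENNReal.ofReal ((Real.sqrt (Xᵀ * X).det)⁻¹ ^ n)

theorem measurable_cutoffMass_integrand :
    Measurable fun X : Matrix (Fin n) (Fin j) ℝ => frameCutoff X *
      ENNReal.ofReal ((Real.sqrt (Xᵀ * X).det)⁻¹ ^ n) := by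
  have hg : Continuous fun X : Matrix (Fin n) (Fin j) ℝ => Xᵀ * X :=
    continuous_id.matrix_transpose.matrix_mul continuous_id
  exact measurable_frameCutoff.mul
    ((hg.matrix_det.sqrt.measurable.inv.pow_const n).ennreal_ofReal)

theorem cutoffMass_ne_zero (hj : j ≤ n) : cutoffMass n j ≠ 0 := by
  rw [cutoffMass, ← pos_iff_ne_zero, lintegral_pos_iff_support measurable_cutoffMass_integrand]
  refine (isOpen_frameCutoff_support.measure_pos volume ⟨coordinateFrame hj, ?_⟩).trans_le
    (measure_mono (μ := volume) ?_)
  -- The Gram matrix of the coordinate frame has determinant 1 > 1/2 and trace j < j + 1, so the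
  -- open support is nonempty.
  · simp only [Set.mem_ofPred_eq, coordinateFrame_gram, Matrix.det_one, Matrix.trace_one,
      Fintype.card_fin]
    constructor <;> norm_num
  · intro X hX
    have h0 : 0 < (Xᵀ * X).det := lt_trans (by norm_num) hX.1
    have h1 : 0 < Real.sqrt (Xᵀ * X).det := Real.sqrt_pos.mpr h0
    have h2 : frameCutoff X = 1 := Set.indicator_of_mem hX _
    rw [Function.mem_support, h2, one_mul]
    exact (ENNReal.ofReal_pos.mpr (by positivity)).ne'

theorem cutoffMass_ne_top (n j : ℕ) : cutoffMass n j ≠ ⊤ := by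
  let B : Set (Matrix (Fin n) (Fin j) ℝ) :=
    Set.univ.pi fun _ => Set.univ.pi fun _ => Metric.closedBall 0 (j + 1)
  have hB : IsCompact B :=
    isCompact_univ_pi fun _ => isCompact_univ_pi fun _ => isCompact_closedBall _ _
  -- On the support the squared entries sum to less than j + 1 ≤ (j + 1)², and det > 1/2 > 1/4 gives
  -- an inverse square root of at most 2.
  have hle : ∀ X : Matrix (Fin n) (Fin j) ℝ, frameCutoff X *
      ENNReal.ofReal ((Real.sqrt (Xᵀ * X).det)⁻¹ ^ n) ≤
        B.indicator (fun _ => ENNReal.ofReal (2 ^ n)) X := by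
    intro X
    by_cases hX : frameCutoff X = 0
    · simp [hX]
    have hmem := Set.mem_of_indicator_ne_zero hX
    have hXB : X ∈ B := by
      intro i _ k _
      have htr : (Xᵀ * X).trace = ∑ k, ∑ i, X i k ^ 2 := by
        simp [Matrix.trace, Matrix.mul_apply, sq]
      have h1 : X i k ^ 2 ≤ ∑ i, X i k ^ 2 :=
        Finset.single_le_sum (f := fun i => X i k ^ 2) (fun _ _ => sq_nonneg _)
          (Finset.mem_univ i)
      have h2 : ∑ i, X i k ^ 2 ≤ ∑ k, ∑ i, X i k ^ 2 :=
        Finset.single_le_sum (f := fun k => ∑ i, X i k ^ 2)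
          (fun _ _ => Finset.sum_nonneg fun _ _ => sq_nonneg _) (Finset.mem_univ k)
      have h3 := hmem.2
      rw [htr] at h3
      have hj0 : (0 : ℝ) ≤ j := Nat.cast_nonneg j
      rw [mem_closedBall_zero_iff, Real.norm_eq_abs]
      exact abs_le_of_sq_le_sq (by nlinarith) (by positivity)
    rw [Set.indicator_of_mem hXB, show frameCutoff X = 1 from Set.indicator_of_mem hmem _, one_mul]
    refine ENNReal.ofReal_le_ofReal (pow_le_pow_left₀ (by positivity) ?_ n)
    rw [inv_le_comm₀ (Real.sqrt_pos.mpr (lt_trans (by norm_num) hmem.1)) (by norm_num)]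
    exact Real.le_sqrt_of_sq_le (by nlinarith [hmem.1])
  refine ((lintegral_mono hle).trans_lt ?_).ne
  rw [lintegral_indicator_const hB.isClosed.measurableSet]
  exact ENNReal.mul_lt_top ENNReal.ofReal_lt_top hB.measure_lt_top

theorem measurable_matrix_inv : Measurable fun T : Matrix (Fin j) (Fin j) ℝ => T⁻¹ := by
  have h : (fun T : Matrix (Fin j) (Fin j) ℝ => T⁻¹) = fun T => T.det⁻¹ • T.adjugate := by
    funext T
    rw [Matrix.inv_def, Ring.inverse_eq_inv']
  rw [h]
  refine measurable_pi_lambda _ fun a => measurable_pi_lambda _ fun b => ?_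
  have hadj : Continuous fun T : Matrix (Fin j) (Fin j) ℝ => T.adjugate a b :=
    continuous_id.matrix_adjugate.matrix_elem a b
  exact continuous_det_matrix.measurable.inv.mul hadj.measurable

theorem lintegral_haarGL_frameCutoff_mul (hj : j ≤ n) {X : Matrix (Fin n) (Fin j) ℝ}
    (hX : (Xᵀ * X).det ≠ 0) :
    ∫⁻ T : Matrix (Fin j) (Fin j) ℝ, frameCutoff (X * T) ∂(haarGL j) = cutoffMass j j := by
  obtain ⟨S, hS, h⟩ := exists_frameCutoff_mul_eq hj hX
  simp only [h]
  rw [lintegral_haarGL_mul_left measurable_frameCutoff hS, lintegral_haarGL measurable_frameCutoff,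
    cutoffMass]
  refine lintegral_congr fun T => ?_
  rw [Matrix.det_mul, Matrix.det_transpose, Real.sqrt_mul_self_eq_abs, mul_comm]

/-- Replacing X by an invertible S with the same Gram matrix, ST⁻¹ = (TS⁻¹)⁻¹, and right invariance
removes S⁻¹. -/
theorem lintegral_haarGL_frameCutoff_mul_inv (hj : j ≤ n) {X : Matrix (Fin n) (Fin j) ℝ}
    (hX : (Xᵀ * X).det ≠ 0) :
    ∫⁻ T : Matrix (Fin j) (Fin j) ℝ, frameCutoff (X * T⁻¹) ∂(haarGL j) =
      ∫⁻ T : Matrix (Fin j) (Fin j) ℝ, frameCutoff T⁻¹ ∂(haarGL j) := by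
  obtain ⟨S, hS, h⟩ := exists_frameCutoff_mul_eq hj hX
  have hu : IsUnit S.det := isUnit_iff_ne_zero.mpr hS
  have hS' : S⁻¹.det ≠ 0 := (Matrix.isUnit_nonsing_inv_det S hu).ne_zero
  rw [← lintegral_haarGL_mul_right (F := fun T => frameCutoff T⁻¹)
    (measurable_frameCutoff.comp measurable_matrix_inv) hS']
  refine lintegral_congr fun T => ?_
  simp only [h, Matrix.mul_inv_rev, Matrix.nonsing_inv_nonsing_inv S hu]

theorem measurable_frame_mul {F : Matrix (Fin n) (Fin j) ℝ → ENNReal} (hF : Measurable F) :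
    Measurable fun p : Matrix (Fin n) (Fin j) ℝ × Matrix (Fin j) (Fin j) ℝ => F (p.1 * p.2) :=
  hF.comp (continuous_fst.matrix_mul continuous_snd).measurable

/-- Integration over frames of a function homogeneous of degree `-n` under `GL(j)`. -/
theorem lintegral_mul_frameCutoff (hj : j ≤ n) {G : Matrix (Fin n) (Fin j) ℝ → ENNReal}
    (hG : Measurable G)
    (hGT : ∀ (X : Matrix (Fin n) (Fin j) ℝ) (T : Matrix (Fin j) (Fin j) ℝ), T.det ≠ 0 →
      G (X * T) = ENNReal.ofReal (|T.det|⁻¹ ^ n) * G X) :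
    ∫⁻ X : Matrix (Fin n) (Fin j) ℝ, G X * frameCutoff X =
      (∫⁻ U, G (U.1 * coordinateFrame hj) ∂(orthogonalHaar n)) * cutoffMass n j := by
  -- Rotating X changes neither dX nor the cutoff, so G(X) may be replaced by its average over all
  -- G(UX).
  have hU : ∀ U : Matrix.orthogonalGroup (Fin n) ℝ,
      ∫⁻ X : Matrix (Fin n) (Fin j) ℝ, G (U.1 * X) * frameCutoff X =
        ∫⁻ X : Matrix (Fin n) (Fin j) ℝ, G X * frameCutoff X := fun U => by
    have := lintegral_matrix_mul_left_of_abs_det_eq_one (hG.mul measurable_frameCutoff)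
      (abs_det_orthogonal U)
    simpa only [Pi.mul_apply, frameCutoff_orthogonal_mul] using this
  have hm : Measurable fun p : Matrix.orthogonalGroup (Fin n) ℝ × Matrix (Fin n) (Fin j) ℝ =>
      G (p.1.1 * p.2) * frameCutoff p.2 :=
    (hG.comp continuous_orthogonal_mul.measurable).mul (measurable_frameCutoff.comp measurable_snd)
  calc ∫⁻ X : Matrix (Fin n) (Fin j) ℝ, G X * frameCutoff X
      = ∫⁻ U : Matrix.orthogonalGroup (Fin n) ℝ,
          ∫⁻ X : Matrix (Fin n) (Fin j) ℝ,
            G (U.1 * X) * frameCutoff X ∂volume ∂(orthogonalHaar n) := by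
        simp [hU]
    _ = ∫⁻ X : Matrix (Fin n) (Fin j) ℝ,
        ∫⁻ U : Matrix.orthogonalGroup (Fin n) ℝ,
          G (U.1 * X) * frameCutoff X ∂(orthogonalHaar n) :=
        lintegral_lintegral_swap hm.aemeasurable
    _ = ∫⁻ X : Matrix (Fin n) (Fin j) ℝ,
          (∫⁻ U, G (U.1 * coordinateFrame hj) ∂(orthogonalHaar n)) *
            (frameCutoff X * ENNReal.ofReal ((Real.sqrt (Xᵀ * X).det)⁻¹ ^ n)) := by
        refine lintegral_congr fun X => ?_
        by_cases hX : frameCutoff X = 0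
        · simp [hX]
        have hGm : ∀ Y : Matrix (Fin n) (Fin j) ℝ,
            Measurable fun U : Matrix.orthogonalGroup (Fin n) ℝ => G (U.1 * Y) :=
          fun Y => hG.comp (measurable_orthogonal_mul Y)
        rw [lintegral_mul_const _ (hGm X)]
        obtain ⟨V, S, hS, hXS⟩ := exists_eq_orthogonal_mul_coordinateFrame_mul hj
          (det_gram_ne_zero_of_frameCutoff_ne_zero hX)
        -- With X = VES, E the coordinate frame, homogeneity extracts S, and right invariance of
        -- Haar measure absorbs V.
        have h1 : ∀ U : Matrix.orthogonalGroup (Fin n) ℝ,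
            G (U.1 * X) = ENNReal.ofReal (|S.det|⁻¹ ^ n) *
              G ((U * V).1 * coordinateFrame hj) := fun U => by
          rw [← hGT _ _ hS, hXS]
          simp only [Submonoid.coe_mul, Matrix.mul_assoc]
        have h2 : Real.sqrt (Xᵀ * X).det = |S.det| := by
          rw [hXS, gram_orthogonal_mul_coordinateFrame_mul, Matrix.det_mul, Matrix.det_transpose,
            Real.sqrt_mul_self_eq_abs]
        simp only [h1]
        rw [lintegral_const_mul' _ _ ENNReal.ofReal_ne_top,
          lintegral_orthogonalHaar_mul_right (hGm (coordinateFrame hj)), h2]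
        ring
    _ = _ := by
        rw [lintegral_const_mul _ measurable_cutoffMass_integrand]
        rfl

/-- This is the GL(j)-invariance of G(X) dX, applied to the substitution X ↦ XT⁻¹. -/
theorem lintegral_mul_mul_comp_mul {G φ χ : Matrix (Fin n) (Fin j) ℝ → ENNReal}
    (hG : Measurable G)
    (hGT : ∀ (X : Matrix (Fin n) (Fin j) ℝ) (T : Matrix (Fin j) (Fin j) ℝ), T.det ≠ 0 →
      G (X * T) = ENNReal.ofReal (|T.det|⁻¹ ^ n) * G X)
    (hφ : Measurable φ) (hχ : Measurable χ) {T : Matrix (Fin j) (Fin j) ℝ} (hT : T.det ≠ 0) :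
    ∫⁻ X : Matrix (Fin n) (Fin j) ℝ, G X * φ X * χ (X * T) =
      ∫⁻ X : Matrix (Fin n) (Fin j) ℝ, G X * χ X * φ (X * T⁻¹) := by
  have hu : IsUnit T.det := isUnit_iff_ne_zero.mpr hT
  have hT' : T⁻¹.det ≠ 0 := (Matrix.isUnit_nonsing_inv_det T hu).ne_zero
  have hmul : Measurable fun X : Matrix (Fin n) (Fin j) ℝ => X * T⁻¹ :=
    (continuous_id.matrix_mul continuous_const).measurable
  have h := lintegral_matrix_mul_right
    (F := fun X => G (X * T⁻¹) * φ (X * T⁻¹) * χ X)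
    (((hG.comp hmul).mul (hφ.comp hmul)).mul hχ) hT
  simp only [Matrix.mul_assoc, Matrix.mul_nonsing_inv T hu, Matrix.mul_one] at h
  rw [h, ← lintegral_const_mul' _ _ ENNReal.ofReal_ne_top]
  refine lintegral_congr fun X => ?_
  have h1 : ENNReal.ofReal (|T.det|⁻¹ ^ n) * ENNReal.ofReal (|T⁻¹.det|⁻¹ ^ n) = 1 := by
    rw [← ofReal_abs_mul_inv_pow, ← Matrix.det_mul, Matrix.mul_nonsing_inv T hu]
    simp
  rw [hGT _ _ hT']
  calc _ = (ENNReal.ofReal (|T.det|⁻¹ ^ n) * ENNReal.ofReal (|T⁻¹.det|⁻¹ ^ n)) *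
        (G X * χ X * φ (X * T⁻¹)) := by ring
    _ = _ := by rw [h1, one_mul]

/-- The point is that the right side does not involve A. Inserting the constant ∫ χ(XT) dT,
exchanging the integrals and moving T to the other factor leaves ∫ χ(AXT⁻¹) dT, which is the same
for every frame AX of full rank. -/
theorem cutoffMass_mul_lintegral (hj : j ≤ n) {G : Matrix (Fin n) (Fin j) ℝ → ENNReal}
    (hG : Measurable G)
    (hGT : ∀ (X : Matrix (Fin n) (Fin j) ℝ) (T : Matrix (Fin j) (Fin j) ℝ), T.det ≠ 0 →
      G (X * T) = ENNReal.ofReal (|T.det|⁻¹ ^ n) * G X)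
    {A : Matrix (Fin n) (Fin n) ℝ} (hA : A.det ≠ 0) :
    cutoffMass j j * ∫⁻ X : Matrix (Fin n) (Fin j) ℝ, G X * frameCutoff (A * X) =
      (∫⁻ X : Matrix (Fin n) (Fin j) ℝ, G X * frameCutoff X) *
        ∫⁻ T : Matrix (Fin j) (Fin j) ℝ, frameCutoff T⁻¹ ∂(haarGL j) := by
  have hmA : Measurable fun X : Matrix (Fin n) (Fin j) ℝ => A * X :=
    (continuous_const.matrix_mul continuous_id).measurable
  have hψ : Measurable fun X : Matrix (Fin n) (Fin j) ℝ => frameCutoff (A * X) :=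
    measurable_frameCutoff.comp hmA
  have hGψ : Measurable fun X : Matrix (Fin n) (Fin j) ℝ => G X * frameCutoff (A * X) := hG.mul hψ
  have hGχ : Measurable fun X : Matrix (Fin n) (Fin j) ℝ => G X * frameCutoff X :=
    hG.mul measurable_frameCutoff
  have hmT := measurable_frame_mul (measurable_frameCutoff (n := n) (j := j))
  have hinv : Measurable fun p : Matrix (Fin n) (Fin j) ℝ × Matrix (Fin j) (Fin j) ℝ =>
      p.1 * p.2⁻¹ :=
    (continuous_fst.matrix_mul continuous_snd).measurable.comp
      (measurable_fst.prodMk (measurable_matrix_inv.comp measurable_snd))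
  have hmT' : Measurable fun p : Matrix (Fin n) (Fin j) ℝ × Matrix (Fin j) (Fin j) ℝ =>
      frameCutoff (A * (p.1 * p.2⁻¹)) :=
    hψ.comp hinv
  have key : ∀ X : Matrix (Fin n) (Fin j) ℝ, ∫⁻ T : Matrix (Fin j) (Fin j) ℝ,
      G X * frameCutoff X * frameCutoff (A * (X * T⁻¹)) ∂(haarGL j) = G X * frameCutoff X *
        ∫⁻ T : Matrix (Fin j) (Fin j) ℝ, frameCutoff T⁻¹ ∂(haarGL j) := by
    intro X
    by_cases hX : frameCutoff X = 0
    · simp [hX]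
    have hAX := det_gram_mul_left_ne_zero hA (det_gram_ne_zero_of_frameCutoff_ne_zero hX)
    have hXm : Measurable fun T : Matrix (Fin j) (Fin j) ℝ => X * T :=
      (continuous_const.matrix_mul continuous_id).measurable
    have hXinv : Measurable fun T : Matrix (Fin j) (Fin j) ℝ => X * T⁻¹ :=
      hXm.comp measurable_matrix_inv
    have hm : Measurable fun T : Matrix (Fin j) (Fin j) ℝ => frameCutoff (A * (X * T⁻¹)) :=
      hψ.comp hXinv
    rw [lintegral_const_mul _ hm, ← lintegral_haarGL_frameCutoff_mul_inv hj hAX]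
    simp only [Matrix.mul_assoc]
  calc cutoffMass j j * ∫⁻ X : Matrix (Fin n) (Fin j) ℝ, G X * frameCutoff (A * X)
      = ∫⁻ X : Matrix (Fin n) (Fin j) ℝ, ∫⁻ T : Matrix (Fin j) (Fin j) ℝ,
          G X * frameCutoff (A * X) * frameCutoff (X * T) ∂(haarGL j) := by
        rw [← lintegral_const_mul _ hGψ]
        refine lintegral_congr fun X => ?_
        by_cases hX : frameCutoff (A * X) = 0
        · simp [hX]
        have hX' := det_gram_ne_zero_of_mul_left A (det_gram_ne_zero_of_frameCutoff_ne_zero hX)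
        have hXm : Measurable fun T : Matrix (Fin j) (Fin j) ℝ => X * T :=
          (continuous_const.matrix_mul continuous_id).measurable
        have hm : Measurable fun T : Matrix (Fin j) (Fin j) ℝ => frameCutoff (X * T) :=
          measurable_frameCutoff.comp hXm
        rw [lintegral_const_mul _ hm, lintegral_haarGL_frameCutoff_mul hj hX', mul_comm]
    _ = ∫⁻ T : Matrix (Fin j) (Fin j) ℝ, ∫⁻ X : Matrix (Fin n) (Fin j) ℝ,
          G X * frameCutoff (A * X) * frameCutoff (X * T) ∂volume ∂(haarGL j) :=
        lintegral_lintegral_swap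
          ((hGψ.comp measurable_fst).mul hmT).aemeasurable
    _ = ∫⁻ T : Matrix (Fin j) (Fin j) ℝ, ∫⁻ X : Matrix (Fin n) (Fin j) ℝ,
          G X * frameCutoff X * frameCutoff (A * (X * T⁻¹)) ∂volume ∂(haarGL j) :=
        lintegral_congr_ae <| ae_haarGL_det_ne_zero.mono fun T hT =>
          lintegral_mul_mul_comp_mul hG hGT hψ measurable_frameCutoff hT
    _ = ∫⁻ X : Matrix (Fin n) (Fin j) ℝ, ∫⁻ T : Matrix (Fin j) (Fin j) ℝ,
          G X * frameCutoff X * frameCutoff (A * (X * T⁻¹)) ∂(haarGL j) :=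
        (lintegral_lintegral_swap
          ((hGχ.comp measurable_fst).mul hmT').aemeasurable).symm
    _ = ∫⁻ X : Matrix (Fin n) (Fin j) ℝ, G X * frameCutoff X *
          ∫⁻ T : Matrix (Fin j) (Fin j) ℝ, frameCutoff T⁻¹ ∂(haarGL j) :=
        lintegral_congr key
    _ = _ := lintegral_mul_const _ hGχ

theorem lintegral_orthogonalHaar_mul_left_of_abs_det_eq_one (hj : j ≤ n)
    {G : Matrix (Fin n) (Fin j) ℝ → ENNReal} (hG : Measurable G)
    (hGT : ∀ (X : Matrix (Fin n) (Fin j) ℝ) (T : Matrix (Fin j) (Fin j) ℝ), T.det ≠ 0 →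
      G (X * T) = ENNReal.ofReal (|T.det|⁻¹ ^ n) * G X)
    {A : Matrix (Fin n) (Fin n) ℝ} (hA : |A.det| = 1) :
    ∫⁻ U, G (A * (U.1 * coordinateFrame hj)) ∂(orthogonalHaar n) =
      ∫⁻ U, G (U.1 * coordinateFrame hj) ∂(orthogonalHaar n) := by
  have hA0 : A.det ≠ 0 := by
    rintro h
    simp [h] at hA
  have hu : IsUnit A.det := isUnit_iff_ne_zero.mpr hA0
  have hA' : A⁻¹.det ≠ 0 := (Matrix.isUnit_nonsing_inv_det A hu).ne_zero
  have hmA : Measurable fun X : Matrix (Fin n) (Fin j) ℝ => A * X :=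
    (continuous_const.matrix_mul continuous_id).measurable
  have hmA' : Measurable fun X : Matrix (Fin n) (Fin j) ℝ => A⁻¹ * X :=
    (continuous_const.matrix_mul continuous_id).measurable
  rw [← ENNReal.mul_left_inj (cutoffMass_ne_zero hj) (cutoffMass_ne_top n j),
    ← lintegral_mul_frameCutoff hj hG hGT,
    ← lintegral_mul_frameCutoff hj (G := fun X => G (A * X)) (hG.comp hmA) (fun X T hT => by
      rw [← Matrix.mul_assoc, hGT _ _ hT])]
  have h1 := lintegral_matrix_mul_left_of_abs_det_eq_one
    (F := fun X => G X * frameCutoff (A⁻¹ * X))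
    (hG.mul (measurable_frameCutoff.comp hmA')) hA
  simp only [← Matrix.mul_assoc, Matrix.nonsing_inv_mul _ hu, Matrix.one_mul] at h1
  rw [h1, ← ENNReal.mul_right_inj (cutoffMass_ne_zero le_rfl) (cutoffMass_ne_top j j),
    cutoffMass_mul_lintegral hj hG hGT hA']
  -- The cases A⁻¹ and 1 share a right side, so ∫ χ(T⁻¹) dT need not be finite or nonzero; only
  -- `cutoffMass j j` is cancelled.
  have h2 := cutoffMass_mul_lintegral hj hG hGT (A := 1) (by simp)
  simpa only [Matrix.one_mul] using h2.symm

end averaging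

theorem frameVolume_div_rpow_mul {n j : ℕ}
    (K : Fin j → ConvexBody (EuclideanSpace ℝ (Fin n))) (X : Matrix (Fin n) (Fin j) ℝ)
    {T : Matrix (Fin j) (Fin j) ℝ} (hT : T.det ≠ 0) :
    (ENNReal.ofReal (frameVolume K (X * T)) / unitBallVolume j) ^ (-(n : ℝ)) =
      ENNReal.ofReal (|T.det|⁻¹ ^ n) *
        (ENNReal.ofReal (frameVolume K X) / unitBallVolume j) ^ (-(n : ℝ)) := by
  have hpos : 0 < |T.det| := abs_pos.mpr hT
  have h0 : ENNReal.ofReal |T.det| ≠ 0 := (ENNReal.ofReal_pos.mpr hpos).ne'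
  -- A negative power is multiplicative in [0, ∞] except for the product 0 · ∞, which is excluded
  -- because |det T| is finite and nonzero. A vanishing mixed volume therefore gives ∞ on both sides
  -- when n > 0.
  rw [frameVolume_mul, ENNReal.ofReal_mul hpos.le, mul_div_assoc, ENNReal.mul_rpow_eq_ite,
    if_neg (by simp [h0])]
  congr 1
  rw [ENNReal.rpow_neg, ENNReal.rpow_natCast, ENNReal.inv_pow,
    ENNReal.ofReal_pow (by positivity), ENNReal.ofReal_inv_of_pos hpos]

end

theorem lemma2p1 {n j : ℕ} (hj : j ≤ n)
    (K : Fin j → ConvexBody (EuclideanSpace ℝ (Fin n)))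
    (g : Matrix.SpecialLinearGroup (Fin n) ℝ) :
    mixedAffineQuermassintegral hj (fun i => (K i).slImage g) =
      mixedAffineQuermassintegral hj K := by
  have hf : Measurable fun v : ℝ =>
      (ENNReal.ofReal v / unitBallVolume j) ^ (-(n : ℝ)) :=
    (ENNReal.measurable_ofReal.div_const _).pow_const _
  unfold mixedAffineQuermassintegral
  rw [lintegral_haar_mixedProjectionVolume hj _ hf, lintegral_haar_mixedProjectionVolume hj _ hf]
  simp only [frameVolume_slImage]
  congr 2
  -- The matrix acting on frames is gᵀ, again of determinant 1.
  exact lintegral_orthogonalHaar_mul_left_of_abs_det_eq_one hj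
    (G := fun X => (ENNReal.ofReal (frameVolume K X) / unitBallVolume j) ^ (-(n : ℝ)))
    (hf.comp (measurable_frameVolume K))
    (fun X T hT => frameVolume_div_rpow_mul K X hT) (by simp [g.2])
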